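/- Let $\lambda$ be an infinite regular cardinal. For a set $S$ of sorts, an $S$-sorted $\lambda$-ary signature $\Sigma$ consists of a set of function symbols $f\colon \sqcap_{i<\alpha}s_i\to s$ and a set of relation symbols $R\colon\sqcap_{i<\alpha}s_i$, each with an ordinal $\alpha<\lambda$ and sorts $s_i,s\in S$. A context is a tuple $\vec{x}=(x_i\colon s_i)_{i<\alpha}$ of distinct sorted variables with $\alpha<\lambda$. Terms in a context $\vec{x}$ are built from the variables $x_i$ by function symbols; ($\lambda$-ary) Horn formulas in $\vec{x}$ are built from atoms $R(\tau_i)_{i<\alpha}$, equations $\tau=\tau'$ between terms of the same sort, and $\top$ by conjunctions $\bigwedge_{i<\alpha}\varphi_i$ with $\alpha<\lambda$. A $\lambda$-ary partial Horn theory $\mathbb{T}$ over $\Sigma$ is a set of Horn sequents $\varphi\vdash_{\vec{x}}\psi$, where $\varphi,\psi$ are Horn formulas in the same context $\vec{x}$. A partial $\Sigma$-structure $M$ consists of sets $M_s$ ($s\in S$), partial maps $[\![f]\!]_M\colon\prod_{i<\alpha}M_{s_i}\rightharpoonup M_s$ and subsets $[\![R]\!]_M\subseteq\prod_{i<\alpha}M_{s_i}$.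 Terms are interpreted as partial maps ($f(\tau_i)_{i<\alpha}$ is defined iff all $\tau_i$ are defined and $[\![f]\!]_M$ is defined at their values); $R(\tau_i)_{i<\alpha}$ holds iff all $\tau_i$ are defined and the tuple of their values lies in $[\![R]\!]_M$; $\tau=\tau'$ holds iff both sides are defined and equal; $\top$ always holds and $\bigwedge$ is interpreted by intersection. A sequent $\varphi\vdash_{\vec{x}}\psi$ is valid in $M$ if $[\![\vec{x}.\varphi]\!]_M\subseteq[\![\vec{x}.\psi]\!]_M$. A homomorphism $h\colon M\to N$ is a family of total maps $h_s\colon M_s\to N_s$ such that $h$ preserves the relations and, whenever $[\![f]\!]_M(\vec{m})$ is defined, $[\![f]\!]_N(h(\vec{m}))$ is defined and equal to $h([\![f]\!]_M(\vec{m}))$. Let $\mathbf{PMod}\,\mathbb{T}$ be the category of partial $\Sigma$-structures in which all sequents of $\mathbb{T}$ are valid, with all homomorphisms between them. Theorem. For a category $\mathscr{A}$, the following are equivalent: 1. $\mathscr{A}$ is locally $\lambda$-presentable. 2. There exist a set $S$, an $S$-sorted $\lambda$-ary signature $\Sigma$ and a $\lambda$-ary partial Horn theory $\mathbb{T}$ over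 $\Sigma$ such that $\mathscr{A}\simeq\mathbf{PMod}\,\mathbb{T}$. -/

import Mathlib

open CategoryTheory

universe w v u

namespace PartialHorn

/-- The ordinals `α < κ`, as a type in the same universe as `κ`. -/
abbrev Arity (κ : Cardinal.{w}) : Type w := κ.ord.ToType

/-- The set `{i | i < α}` of indices, for `α < κ`. -/
abbrev Arity.Idx {κ : Cardinal.{w}} (α : Arity κ) : Type w := {i : Arity κ // i < α}

/-- An `S`-sorted `κ`-ary signature: a set of function symbols `f : ⊓_{i<α} s_i → s` and a set of
relation symbols `R : ⊓_{i<α} s_i`, with `α < κ`. -/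
structure Signature (κ : Cardinal.{w}) (S : Type w) where
  Func : Type w
  funcArity : Func → Arity κ
  funcDom : (f : Func) → (funcArity f).Idx → S
  funcCod : Func → S
  Rel : Type w
  relArity : Rel → Arity κ
  relDom : (R : Rel) → (relArity R).Idx → S

/-- A `κ`-ary context `(x_i : s_i)_{i<α}`. The names of the (pairwise distinct) variables are
immaterial: the variable `x_i` is represented by its index `i`. -/
structure Context (κ : Cardinal.{w}) (S : Type w) where
  length : Arity κ
  sort : length.Idx → S

variable {κ : Cardinal.{w}} {S : Type w}

/-- Terms over `Sg` in the context `x` (all variables occur in `x`), indexed by their type. -/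
inductive Term (Sg : Signature κ S) (x : Context κ S) : S → Type w
  | var (i : x.length.Idx) : Term Sg x (x.sort i)
  | app (f : Sg.Func) (τ : (i : (Sg.funcArity f).Idx) → Term Sg x (Sg.funcDom f i)) :
      Term Sg x (Sg.funcCod f)

/-- `κ`-ary Horn formulas over `Sg` in the context `x`. -/
inductive Formula (Sg : Signature κ S) (x : Context κ S) : Type w
  | rel (R : Sg.Rel) (τ : (i : (Sg.relArity R).Idx) → Term Sg x (Sg.relDom R i)) : Formula Sg x
  | eq {s : S} (τ τ' : Term Sg x s) : Formula Sg x
  | top : Formula Sg x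
  | conj (α : Arity κ) (φ : α.Idx → Formula Sg x) : Formula Sg x

/-- A `κ`-ary Horn sequent `φ ⊢_x ψ`. -/
structure Sequent (Sg : Signature κ S) where
  ctx : Context κ S
  lhs : Formula Sg ctx
  rhs : Formula Sg ctx

/-- A `κ`-ary partial Horn theory over `Sg`: a set of `κ`-ary Horn sequents. -/
abbrev Theory (Sg : Signature κ S) : Type w := Set (Sequent Sg)

/-- A partial `Sg`-structure. A partial map into `Y` is a map into `Part Y`. -/
structure PStr (Sg : Signature κ S) where
  carrier : S → Type w
  func (f : Sg.Func) :
    ((i : (Sg.funcArity f).Idx) → carrier (Sg.funcDom f i)) → Part (carrier (Sg.funcCod f))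
  rel (R : Sg.Rel) : Set ((i : (Sg.relArity R).Idx) → carrier (Sg.relDom R i))

/-- A family of partial elements, as a partial family: it is defined iff every member is. -/
def partPi {ι : Type*} {β : ι → Type*} (p : (i : ι) → Part (β i)) : Part ((i : ι) → β i) :=
  ⟨∀ i, (p i).Dom, fun h i => (p i).get (h i)⟩

variable {Sg : Signature κ S}

/-- The interpretation of a term in context, as a partial map `∏_{i<α} M_{s_i} ⇀ M_s`. -/
def Term.interp (M : PStr Sg) {x : Context κ S} {s : S} (τ : Term Sg x s)
    (m : (i : x.length.Idx) → M.carrier (x.sort i)) : Part (M.carrier s) :=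
  match τ with
    | .var i => Part.some (m i)
    | .app f τ => (partPi fun i => (τ i).interp M m).bind (M.func f)

/-- The interpretation of a Horn formula in context, as a subset of `∏_{i<α} M_{s_i}`.
Here `v ∈ τ.interp M m` says that `τ` is defined at `m` with value `v`. -/
def Formula.interp (M : PStr Sg) {x : Context κ S} (φ : Formula Sg x) :
    Set ((i : x.length.Idx) → M.carrier (x.sort i)) :=
  match φ with
    | .rel R τ => {m | ∃ v, (∀ i, v i ∈ (τ i).interp M m) ∧ v ∈ M.rel R}
    | .eq τ τ' => {m | ∃ v, v ∈ τ.interp M m ∧ v ∈ τ'.interp M m}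
    | .top => Set.univ
    | .conj _ φ => ⋂ i, (φ i).interp M

/-- Validity of a Horn sequent in a partial structure. -/
def Sequent.Valid (M : PStr Sg) (σ : Sequent Sg) : Prop :=
  σ.lhs.interp M ⊆ σ.rhs.interp M

/-- `Sg`-homomorphisms: sortwise total maps `h` such that, whenever `f` is defined at `m` in `M`,
it is defined at `h m` in `N` with value `h (f m)`, and such that relations are preserved. -/
@[ext]
structure PStr.Hom (M N : PStr Sg) where
  toFun (s : S) : M.carrier s → N.carrier s
  map_func (f : Sg.Func) (m : (i : (Sg.funcArity f).Idx) → M.carrier (Sg.funcDom f i))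
    (v : M.carrier (Sg.funcCod f)) (hv : v ∈ M.func f m) :
    toFun (Sg.funcCod f) v ∈ N.func f (fun i => toFun (Sg.funcDom f i) (m i))
  map_rel (R : Sg.Rel) (m : (i : (Sg.relArity R).Idx) → M.carrier (Sg.relDom R i))
    (hm : m ∈ M.rel R) : (fun i => toFun (Sg.relDom R i) (m i)) ∈ N.rel R

/-- The category of partial `Sg`-structures and `Sg`-homomorphisms. -/
instance : Category.{w} (PStr Sg) where
  Hom := PStr.Hom
  id M := ⟨fun _ a => a, fun _ _ _ hv => hv, fun _ _ hm => hm⟩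
  comp g h := ⟨fun s a => h.toFun s (g.toFun s a),
    fun f _ _ hv => h.map_func f _ _ (g.map_func f _ _ hv),
    fun R _ hm => h.map_rel R _ (g.map_rel R _ hm)⟩

/-- The partial models of a partial Horn theory, among the partial structures. -/
def Theory.isModel (T : Theory Sg) : ObjectProperty (PStr Sg) :=
  fun M => ∀ σ ∈ T, σ.Valid M

/-- The category of partial models of `T`: a full subcategory of the category of partial
structures. -/
abbrev PMod (T : Theory Sg) := T.isModel.FullSubcategory

end PartialHorn

/-! Models to presentability. The main tool is the term model of a family of structures with named
generators: closed terms defined in every member, modulo equality in every member. The family may be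
large, yet its term model is small. A Horn formula holds there as soon as it holds in all members
(`Family.mem_interp_formula`), so families of models yield models. The family of all cocones gives
colimits; the family of all models with a tuple satisfying `φ` gives an object representing `M ↦
⟦x.φ⟧`. Since contexts, arities and conjunctions have size below `κ`, satisfaction in a `κ`-filtered
colimit is witnessed at some stage (`exists_stage_formula`), so the representing objects are
`κ`-presentable. They form a strong generator, since they detect elements, definedness and
relations.

Presentability to models. Let `i : D ⥤ A` be a small version of the `κ`-presentable objects. The
nerve of `X` consists of the morphisms `i d ⟶ X`, with partial operations that extend a family along
jointly epic legs. The theory is everything true in all nerves, so no axioms need listing. Density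
makes the nerve fully faithful. A model is a presheaf on `D` whose category of elements is
`κ`-filtered, by `exists_act_eq`; presentability then identifies it with the nerve of the colimit of
its elements (`isIso_toNerve`). -/

namespace PartialHorn

open Limits

variable {κ : Cardinal.{w}} {S : Type w} {Sg : Signature κ S}

/-! ### Preservation of terms and Horn formulas by homomorphisms -/

/-- A family of elements lies in `partPi p` iff it does so componentwise. -/
lemma mem_partPi {ι : Type*} {β : ι → Type*} {p : (i : ι) → Part (β i)} {v : (i : ι) → β i} :
    v ∈ partPi p ↔ ∀ i, v i ∈ p i :=
  ⟨fun ⟨h, e⟩ i => ⟨h i, congrFun e i⟩, fun h => ⟨fun i => (h i).1, funext fun i => (h i).2⟩⟩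

lemma Term.mem_interp_app {M : PStr Sg} {x : Context κ S} {f : Sg.Func}
    {τ : (i : (Sg.funcArity f).Idx) → Term Sg x (Sg.funcDom f i)}
    {m : (i : x.length.Idx) → M.carrier (x.sort i)} {v : M.carrier (Sg.funcCod f)} :
    v ∈ (Term.app f τ).interp M m ↔ ∃ w, (∀ i, w i ∈ (τ i).interp M m) ∧ v ∈ M.func f w := by
  simp only [Term.interp, Part.mem_bind_iff, mem_partPi]

lemma Term.mem_interp_var {M : PStr Sg} {x : Context κ S} {i : x.length.Idx}
    {m : (i : x.length.Idx) → M.carrier (x.sort i)} {v : M.carrier (x.sort i)} :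
    v ∈ (Term.var (Sg := Sg) i).interp M m ↔ v = m i := by
  simp only [Term.interp, Part.mem_some_iff]

namespace PStr.Hom

variable {M N : PStr Sg} (h : PStr.Hom M N)

lemma mem_interp_term {x : Context κ S} {s : S} (τ : Term Sg x s)
    (m : (i : x.length.Idx) → M.carrier (x.sort i)) {v : M.carrier s} (hv : v ∈ τ.interp M m) :
    h.toFun s v ∈ τ.interp N (fun i => h.toFun _ (m i)) := by
  induction τ with
  | var i =>
    rw [Term.mem_interp_var] at hv ⊢
    rw [hv]
  | app f τ ih =>
    rw [Term.mem_interp_app] at hv ⊢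
    obtain ⟨w, hw, hv⟩ := hv
    exact ⟨_, fun i => ih i (hw i), h.map_func f w v hv⟩

lemma mem_interp_formula {x : Context κ S} (φ : Formula Sg x)
    (m : (i : x.length.Idx) → M.carrier (x.sort i)) (hm : m ∈ φ.interp M) :
    (fun i => h.toFun _ (m i)) ∈ φ.interp N := by
  induction φ with
  | rel R τ =>
    obtain ⟨v, hv, hR⟩ := hm
    exact ⟨_, fun i => h.mem_interp_term _ _ (hv i), h.map_rel R v hR⟩
  | eq τ τ' =>
    obtain ⟨v, hv, hv'⟩ := hm
    exact ⟨_, h.mem_interp_term _ _ hv, h.mem_interp_term _ _ hv'⟩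
  | top => trivial
  | conj α φ ih =>
    simp only [Formula.interp, Set.mem_iInter] at hm ⊢
    exact fun i => ih i (hm i)

end PStr.Hom

/-! ### Term models of families -/

/-- Closed terms over a sorted set `G` of generators. -/
inductive GTerm (Sg : Signature κ S) (G : S → Type w) : S → Type w
  | gen {s : S} (g : G s) : GTerm Sg G s
  | app (f : Sg.Func) (τ : (i : (Sg.funcArity f).Idx) → GTerm Sg G (Sg.funcDom f i)) :
      GTerm Sg G (Sg.funcCod f)

/-- The partial value of a closed term under an assignment of the generators. -/
def GTerm.eval {G : S → Type w} (M : PStr Sg) (ρ : ∀ s, G s → M.carrier s) {s : S}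
    (t : GTerm Sg G s) : Part (M.carrier s) :=
  match t with
    | .gen g => Part.some (ρ _ g)
    | .app f τ => (partPi fun i => (τ i).eval M ρ).bind (M.func f)

lemma GTerm.mem_eval_app {G : S → Type w} {M : PStr Sg} {ρ : ∀ s, G s → M.carrier s}
    {f : Sg.Func} {τ : (i : (Sg.funcArity f).Idx) → GTerm Sg G (Sg.funcDom f i)}
    {v : M.carrier (Sg.funcCod f)} :
    v ∈ (GTerm.app f τ).eval M ρ ↔ ∃ w, (∀ i, w i ∈ (τ i).eval M ρ) ∧ v ∈ M.func f w := by
  simp only [GTerm.eval, Part.mem_bind_iff, mem_partPi]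

/-- A family of partial structures, each equipped with an assignment of the generators `G`. -/
structure Family (Sg : Signature κ S) (G : S → Type w) (Ω : Type u) where
  str : Ω → PStr Sg
  val (ω : Ω) (s : S) : G s → (str ω).carrier s

namespace Family

variable {G : S → Type w} {Ω : Type u} (K : Family Sg G Ω)

/-- The closed terms which are defined in all members of a family. -/
def Defined (s : S) : Type w :=
  {t : GTerm Sg G s // ∀ ω, (t.eval (K.str ω) (K.val ω)).Dom}

/-- The identification of closed terms which have the same value in all members of a family. -/
def setoid (s : S) : Setoid (K.Defined s) where
  r t t' := ∀ ω, t.1.eval (K.str ω) (K.val ω) = t'.1.eval (K.str ω) (K.val ω)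
  iseqv := ⟨fun _ _ => rfl, fun h ω => (h ω).symm, fun h h' ω => (h ω).trans (h' ω)⟩

/-- The value of a class of closed terms in a member of a family. -/
def ev (ω : Ω) (s : S) : Quotient (K.setoid s) → (K.str ω).carrier s :=
  Quotient.lift (fun t => (t.1.eval (K.str ω) (K.val ω)).get (t.2 ω)) fun t t' h => by
    have := h ω
    exact Part.get_eq_get_of_eq _ (t.2 ω) this

lemma ev_mk_mem (ω : Ω) {s : S} (t : K.Defined s) :
    K.ev ω s (Quotient.mk (K.setoid s) t) ∈ t.1.eval (K.str ω) (K.val ω) :=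
  Part.get_mem _

lemma ev_ext {s : S} {a b : Quotient (K.setoid s)} (h : ∀ ω, K.ev ω s a = K.ev ω s b) :
    a = b := by
  induction a using Quotient.inductionOn with | _ t =>
  induction b using Quotient.inductionOn with | _ t' =>
  refine Quotient.sound fun ω => ?_
  have h₁ := K.ev_mk_mem ω t
  rw [h ω] at h₁
  exact Part.mem_right_unique h₁ (K.ev_mk_mem ω t')

lemma dom_app (f : Sg.Func)
    (m : (i : (Sg.funcArity f).Idx) → Quotient (K.setoid (Sg.funcDom f i)))
    (h : ∀ ω, ((K.str ω).func f fun i => K.ev ω _ (m i)).Dom) (ω : Ω) :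
    ((GTerm.app f fun i => (m i).out.1).eval (K.str ω) (K.val ω)).Dom := by
  obtain ⟨v, hv⟩ := Part.dom_iff_mem.1 (h ω)
  refine Part.dom_iff_mem.2 ⟨v, GTerm.mem_eval_app.2 ⟨_, fun i => ?_, hv⟩⟩
  conv in K.ev ω _ (m i) => rw [← (m i).out_eq]
  exact K.ev_mk_mem ω _

/-- The term model of a family: the "image" of the closed terms in its product. -/
noncomputable def termModel : PStr Sg where
  carrier s := Quotient (K.setoid s)
  func f m := ⟨∀ ω, ((K.str ω).func f fun i => K.ev ω _ (m i)).Dom,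
    fun h => Quotient.mk _ ⟨.app f fun i => (m i).out.1, K.dom_app f m h⟩⟩
  rel R := {m | ∀ ω, (fun i => K.ev ω _ (m i)) ∈ (K.str ω).rel R}

/-- The representatives chosen in `termModel` are immaterial: the evaluations are jointly injective,
so the term model embeds in the product and inherits the graphs of its operations. -/
lemma mem_termModel_func {f : Sg.Func}
    {m : (i : (Sg.funcArity f).Idx) → K.termModel.carrier (Sg.funcDom f i)}
    {v : K.termModel.carrier (Sg.funcCod f)} :
    v ∈ K.termModel.func f m ↔
      ∀ ω, K.ev ω _ v ∈ (K.str ω).func f fun i => K.ev ω _ (m i) := by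
  have key (h : (K.termModel.func f m).Dom) (ω : Ω) :
      K.ev ω _ ((K.termModel.func f m).get h) ∈ (K.str ω).func f fun i => K.ev ω _ (m i) := by
    obtain ⟨w, hw, hv⟩ := GTerm.mem_eval_app.1
      (K.ev_mk_mem ω ⟨.app f fun i => (m i).out.1, K.dom_app f m h⟩)
    convert! hv using 2
    funext i
    refine Part.mem_unique ?_ (hw i)
    conv in K.ev ω _ (m i) => rw [← (m i).out_eq]
    exact K.ev_mk_mem ω _
  constructor
  · rintro ⟨h, rfl⟩ ω
    exact key h ω
  · intro h
    have hd : (K.termModel.func f m).Dom := fun ω => (h ω).1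
    exact ⟨hd, K.ev_ext fun ω => Part.mem_unique (key hd ω) (h ω)⟩

/-- The homomorphism from the term model to a member of the family. -/
noncomputable def evHom (ω : Ω) : PStr.Hom K.termModel (K.str ω) where
  toFun := K.ev ω
  map_func _ _ _ hv := K.mem_termModel_func.1 hv ω
  map_rel _ _ hm := hm ω

/-- The generators, as elements of the term model. -/
noncomputable def gen {s : S} (g : G s) : K.termModel.carrier s :=
  Quotient.mk (K.setoid s) ⟨.gen g, fun _ => trivial⟩

/-- The term model is closed under the operations defined in all members, so no value computed
memberwise is lost. -/
lemma exists_mem_interp_term {x : Context κ S} {s : S} (τ : Term Sg x s)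
    (m : (i : x.length.Idx) → K.termModel.carrier (x.sort i))
    (h : ∀ ω, (τ.interp (K.str ω) fun i => K.ev ω _ (m i)).Dom) :
    ∃ v, v ∈ τ.interp K.termModel m := by
  induction τ with
  | var i => exact ⟨m i, Term.mem_interp_var.2 rfl⟩
  | app f τ ih =>
    have h' (ω) := (Part.dom_iff_mem.1 (h ω))
    simp only [Term.mem_interp_app] at h'
    choose v w hw hv using h'
    choose a ha using fun i => ih i fun ω => (hw ω i).1
    have e (ω) : w ω = fun i => K.ev ω _ (a i) :=
      funext fun i => Part.mem_unique (hw ω i) ((K.evHom ω).mem_interp_term _ _ (ha i))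
    have hd : (K.termModel.func f a).Dom := fun ω => e ω ▸ (hv ω).1
    exact ⟨_, Term.mem_interp_app.2 ⟨a, ha, Part.get_mem hd⟩⟩

lemma mem_interp_term {x : Context κ S} {s : S} {τ : Term Sg x s}
    {m : (i : x.length.Idx) → K.termModel.carrier (x.sort i)} {v : K.termModel.carrier s}
    (h : ∀ ω, K.ev ω s v ∈ τ.interp (K.str ω) fun i => K.ev ω _ (m i)) :
    v ∈ τ.interp K.termModel m := by
  obtain ⟨v', hv'⟩ := K.exists_mem_interp_term τ m fun ω => (h ω).1
  convert hv'
  exact K.ev_ext fun ω => Part.mem_unique (h ω) ((K.evHom ω).mem_interp_term _ _ hv')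

lemma mem_interp_formula {x : Context κ S} {φ : Formula Sg x}
    {m : (i : x.length.Idx) → K.termModel.carrier (x.sort i)}
    (h : ∀ ω, (fun i => K.ev ω _ (m i)) ∈ φ.interp (K.str ω)) :
    m ∈ φ.interp K.termModel := by
  induction φ with
  | rel R τ =>
    choose v hv hR using h
    choose a ha using fun i => K.exists_mem_interp_term (τ i) m fun ω => (hv ω i).1
    have e (ω) : v ω = fun i => K.ev ω _ (a i) :=
      funext fun i => Part.mem_unique (hv ω i) ((K.evHom ω).mem_interp_term _ _ (ha i))
    exact ⟨a, ha, fun ω => e ω ▸ hR ω⟩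
  | eq τ τ' =>
    choose v hv hv' using h
    obtain ⟨a, ha⟩ := K.exists_mem_interp_term τ m fun ω => (hv ω).1
    refine ⟨a, ha, K.mem_interp_term fun ω => ?_⟩
    have e : v ω = K.ev ω _ a :=
      Part.mem_unique (hv ω) ((K.evHom ω).mem_interp_term _ _ ha)
    exact e ▸ hv' ω
  | top => trivial
  | conj α φ ih =>
    simp only [Formula.interp, Set.mem_iInter] at h ⊢
    exact fun i => ih i fun ω => h ω i

/-- The premise passes to each member along `evHom`, and the conclusion, true in all members, comes
back. -/
lemma isModel_termModel {T : Theory Sg} (h : ∀ ω, T.isModel (K.str ω)) :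
    T.isModel K.termModel := fun σ hσ _ hm =>
  K.mem_interp_formula fun ω => h ω σ hσ ((K.evHom ω).mem_interp_formula _ _ hm)

lemma hom_ext {N : PStr Sg} {a b : PStr.Hom K.termModel N}
    (h : ∀ (s : S) (g : G s), a.toFun s (K.gen g) = b.toFun s (K.gen g)) : a = b := by
  have key {s : S} (t : GTerm Sg G s) (ht : ∀ ω, (t.eval (K.str ω) (K.val ω)).Dom) :
      a.toFun s (Quotient.mk (K.setoid s) ⟨t, ht⟩) =
        b.toFun s (Quotient.mk (K.setoid s) ⟨t, ht⟩) := by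
    induction t with
    | gen g => exact h _ g
    | app f τ ih =>
      -- Subterms of an everywhere defined term are everywhere defined, so their classes exist and
      -- induction applies to them.
      have h' (ω) := K.ev_mk_mem ω ⟨_, ht⟩
      simp only [GTerm.mem_eval_app] at h'
      choose w hw hv using h'
      let c (i) : K.termModel.carrier (Sg.funcDom f i) :=
        Quotient.mk (K.setoid _) ⟨τ i, fun ω => (hw ω i).1⟩
      have hc : (Quotient.mk (K.setoid _) ⟨_, ht⟩ : K.termModel.carrier _) ∈
          K.termModel.func f c := K.mem_termModel_func.2 fun ω => by
        have e : w ω = fun i => K.ev ω _ (c i) :=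
          funext fun i => Part.mem_unique (hw ω i)
            (K.ev_mk_mem ω ⟨τ i, fun ω => (hw ω i).1⟩)
        exact e ▸ hv ω
      have h₁ := a.map_func f _ _ hc
      simp only [c, ih] at h₁
      exact Part.mem_unique h₁ (b.map_func f _ _ hc)
  ext s q
  induction q using Quotient.inductionOn with | _ t => exact key t.1 t.2

end Family

/-! ### Cocompleteness -/

section Colimits

variable {T : Theory Sg}

/-- The underlying function, on elements of sort `s`, of a morphism of models. -/
abbrev appl {M N : PMod T} (f : M ⟶ N) (s : S) : M.obj.carrier s → N.obj.carrier s :=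
  PStr.Hom.toFun f.hom s

variable {J : Type w} [SmallCategory J] (F : J ⥤ PMod T)

/-- The family of all cocones over a diagram of models. -/
def coconeFamily : Family Sg (fun s => Σ j, (F.obj j).obj.carrier s) (Cocone F) where
  str c := c.pt.obj
  val c s x := appl (c.ι.app x.1) s x.2

lemma coconeFamily_gen_map {j j' : J} (g : j ⟶ j') (s : S) (x : (F.obj j).obj.carrier s) :
    (coconeFamily F).gen ⟨j', appl (F.map g) s x⟩ = (coconeFamily F).gen ⟨j, x⟩ :=
  (coconeFamily F).ev_ext fun c => congrArg (fun h => appl h s x) (c.w g)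

/-- The colimit cocone over a diagram of models: the term model of the family of all cocones. -/
noncomputable def colimitCocone : Cocone F where
  pt := ⟨(coconeFamily F).termModel, (coconeFamily F).isModel_termModel fun c => c.pt.property⟩
  ι :=
    { app j := ObjectProperty.homMk
        { toFun s x := (coconeFamily F).gen ⟨j, x⟩
          map_func f m v hv := (coconeFamily F).mem_termModel_func.2 fun c =>
            PStr.Hom.map_func (c.ι.app j).hom f m v hv
          map_rel R m hm c := PStr.Hom.map_rel (c.ι.app j).hom R m hm }
      naturality j j' g := by
        ext : 1
        exact PStr.Hom.ext (funext fun s => funext fun x => coconeFamily_gen_map F g s x) }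

/-- The universal property of `colimitCocone`. -/
noncomputable def isColimitColimitCocone : IsColimit (colimitCocone F) where
  -- The cocone `c` is itself a member of the family, so evaluation at it is the mediating morphism.
  desc c := ObjectProperty.homMk ((coconeFamily F).evHom c)
  fac c j := rfl
  uniq c m hm := by
    ext : 1
    refine (coconeFamily F).hom_ext fun s g => ?_
    exact congrArg (fun h => appl h s g.2) (hm g.1)

instance : HasColimitsOfSize.{w, w} (PMod T) where
  has_colimits_of_shape _ _ := ⟨fun F => ⟨⟨⟨_, isColimitColimitCocone F⟩⟩⟩⟩

end Colimits

/-! ### Models representing formulas in context -/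

section Representing

variable {T : Theory Sg} {x : Context κ S} (φ : Formula Sg x)

variable (T) in
/-- The family of all models with a tuple satisfying the formula `φ`. -/
def formulaFamily : Family Sg (fun s => {i // x.sort i = s})
    (Σ M : PMod T, {m // m ∈ φ.interp M.obj}) where
  str ω := ω.1.obj
  val ω _ i := i.2 ▸ ω.2.1 i.1

variable (T) in
/-- The model which represents `M ↦ ⟦x.φ⟧`. -/
noncomputable def representing : PMod T :=
  ⟨(formulaFamily T φ).termModel, (formulaFamily T φ).isModel_termModel fun ω => ω.1.property⟩

variable (T) in
/-- The generic tuple satisfying the formula `φ`. -/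
noncomputable def generic (i : x.length.Idx) : (representing T φ).obj.carrier (x.sort i) :=
  (formulaFamily T φ).gen ⟨i, rfl⟩

lemma generic_mem : generic T φ ∈ φ.interp (representing T φ).obj :=
  (formulaFamily T φ).mem_interp_formula fun ω => ω.2.2

variable {φ}

/-- The homomorphism from the representing model which corresponds to a tuple. -/
noncomputable def fromRepresenting {M : PMod T} (m : (i : x.length.Idx) → M.obj.carrier (x.sort i))
    (hm : m ∈ φ.interp M.obj) : representing T φ ⟶ M :=
  ObjectProperty.homMk ((formulaFamily T φ).evHom ⟨M, m, hm⟩)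

lemma fromRepresenting_generic {M : PMod T}
    (m : (i : x.length.Idx) → M.obj.carrier (x.sort i)) (hm : m ∈ φ.interp M.obj)
    (i : x.length.Idx) : appl (fromRepresenting m hm) _ (generic T φ i) = m i := rfl

lemma representing_hom_ext {M : PMod T} {a b : representing T φ ⟶ M}
    (h : ∀ i, appl a _ (generic T φ i) = appl b _ (generic T φ i)) : a = b := by
  ext : 1
  refine (formulaFamily T φ).hom_ext ?_
  rintro _ ⟨i, rfl⟩
  exact h i

lemma apply_generic_mem {M : PMod T} (a : representing T φ ⟶ M) :
    (fun i => appl a _ (generic T φ i)) ∈ φ.interp M.obj :=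
  PStr.Hom.mem_interp_formula a.hom φ _ (generic_mem φ)

end Representing

end PartialHorn

/-! ### Arities and `κ`-filtered colimits of models -/

namespace PartialHorn

open Limits

variable {κ : Cardinal.{w}} {S : Type w} {Sg : Signature κ S}

lemma Arity.hasCardinalLT_idx (α : Arity κ) : HasCardinalLT α.Idx κ := by
  rw [hasCardinalLT_iff_cardinal_mk_lt]
  exact (Cardinal.mk_Iio_lt α (by simp)).trans_eq (Cardinal.mk_ord_toType κ)

/-- Every type of cardinality `< κ` is in bijection with the indices below some `α < κ`. -/
lemma Arity.exists_equiv {X : Type w} (hX : HasCardinalLT X κ) :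
    ∃ α : Arity κ, Nonempty (α.Idx ≃ X) := by
  rw [hasCardinalLT_iff_cardinal_mk_lt] at hX
  have h : (Cardinal.mk X).ord < Ordinal.type (α := κ.ord.ToType) (· < ·) := by
    simpa using Cardinal.ord_lt_ord.2 hX
  refine ⟨Ordinal.enum (α := κ.ord.ToType) (· < ·) ⟨_, h⟩, ?_⟩
  rw [← Cardinal.eq]
  have := Ordinal.typein_enum (α := κ.ord.ToType) (· < ·) h
  exact (Ordinal.card_typein (α := κ.ord.ToType) (r := (· < ·)) _).symm.trans
    ((congrArg Ordinal.card this).trans (Cardinal.card_ord _))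

lemma exists_arity_one (κ : Cardinal.{w}) [Fact κ.IsRegular] :
    ∃ α : Arity κ, Nonempty (α.Idx ≃ PUnit.{w + 1}) :=
  Arity.exists_equiv (hasCardinalLT_of_finite _ _ (Cardinal.IsRegular.aleph0_le Fact.out))

variable {T : Theory Sg}

@[simp]
lemma appl_id (M : PMod T) (s : S) (x : M.obj.carrier s) : appl (𝟙 M) s x = x := rfl

@[simp]
lemma appl_comp {M N P : PMod T} (f : M ⟶ N) (g : N ⟶ P) (s : S) (x : M.obj.carrier s) :
    appl (f ≫ g) s x = appl g s (appl f s x) := rfl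

lemma hom_ext' {M N : PMod T} {f g : M ⟶ N} (h : ∀ s x, appl f s x = appl g s x) : f = g := by
  ext : 1
  exact PStr.Hom.ext (funext fun s => funext fun x => h s x)

namespace FilteredColimit

variable [Fact κ.IsRegular] {J : Type w} [SmallCategory J] [IsCardinalFiltered J κ]
  (F : J ⥤ PMod T)

section

omit [Fact κ.IsRegular] [IsCardinalFiltered J κ]

lemma appl_map_comp {i j k : J} (f : i ⟶ j) (g : j ⟶ k) (s : S) (x : (F.obj i).obj.carrier s) :
    appl (F.map (f ≫ g)) s x = appl (F.map g) s (appl (F.map f) s x) := by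
  rw [F.map_comp]; rfl

end

variable (κ) in
/-- Elements of a filtered diagram of models are identified if they become equal at some stage. -/
def setoid (s : S) : Setoid (Σ j, (F.obj j).obj.carrier s) where
  r x y := ∃ (k : J) (f : x.1 ⟶ k) (g : y.1 ⟶ k), appl (F.map f) s x.2 = appl (F.map g) s y.2
  iseqv :=
    { refl x := ⟨x.1, 𝟙 _, 𝟙 _, rfl⟩
      symm := fun ⟨k, f, g, h⟩ => ⟨k, g, f, h.symm⟩
      trans := fun {x y z} ⟨k, f, g, h⟩ ⟨k', f', g', h'⟩ => by
        have := isFiltered_of_isCardinalFiltered J κ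
        obtain ⟨l, a, b, hab⟩ := IsFiltered.span g f'
        refine ⟨l, f ≫ a, g' ≫ b, ?_⟩
        rw [appl_map_comp, h, ← appl_map_comp, hab, appl_map_comp, h', ← appl_map_comp] }

variable (κ) in
/-- The carriers of the filtered colimit of models. -/
abbrev Carrier (s : S) : Type w := Quotient (setoid κ F s)

variable (κ) in
/-- The class of an element in the filtered colimit. -/
def mk (j : J) {s : S} (x : (F.obj j).obj.carrier s) : Carrier κ F s :=
  Quotient.mk (setoid κ F s) ⟨j, x⟩

lemma mk_map {j k : J} (f : j ⟶ k) {s : S} (x : (F.obj j).obj.carrier s) :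
    mk κ F k (appl (F.map f) s x) = mk κ F j x :=
  Quotient.sound ⟨k, 𝟙 k, f, by simp⟩

lemma mk_eq_mk {j j' : J} {s : S} {x : (F.obj j).obj.carrier s} {y : (F.obj j').obj.carrier s}
    (h : mk κ F j x = mk κ F j' y) :
    ∃ (k : J) (f : j ⟶ k) (g : j' ⟶ k), appl (F.map f) s x = appl (F.map g) s y :=
  Quotient.exact h

section Families

variable {ι : Type w} (hι : HasCardinalLT ι κ) {σ : ι → S}

include hι

/-- A small family of elements of the filtered colimit comes from a single stage. -/
lemma exists_lift (m : (i : ι) → Carrier κ F (σ i)) :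
    ∃ (j : J) (x : (i : ι) → (F.obj j).obj.carrier (σ i)), m = fun i => mk κ F j (x i) := by
  refine ⟨IsCardinalFiltered.max (fun i => (m i).out.1) hι, fun i =>
    appl (F.map (IsCardinalFiltered.toMax _ hι i)) _ (m i).out.2, funext fun i => ?_⟩
  rw [mk_map]
  exact (m i).out_eq.symm

/-- A small family of equalities in the filtered colimit holds at a single stage. -/
lemma exists_eq {j j' : J} {x : (i : ι) → (F.obj j).obj.carrier (σ i)}
    {y : (i : ι) → (F.obj j').obj.carrier (σ i)} (h : ∀ i, mk κ F j (x i) = mk κ F j' (y i)) :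
    ∃ (k : J) (f : j ⟶ k) (g : j' ⟶ k),
      ∀ i, appl (F.map f) _ (x i) = appl (F.map g) _ (y i) := by
  have := isFiltered_of_isCardinalFiltered J κ
  choose k f g e using fun i => mk_eq_mk F (h i)
  obtain ⟨l, a, b, hl⟩ := IsCardinalFiltered.wideSpan f hι
  obtain ⟨l', a', b', hl'⟩ := IsCardinalFiltered.wideSpan g hι
  -- The objects `k i` now map to two unrelated stages `l` and `l'`; a further stage must reconcile
  -- these maps for all `i` at once.
  obtain ⟨n, c, d, hn⟩ : ∃ (n : J) (c : l ⟶ n) (d : l' ⟶ n), ∀ i, a i ≫ c = a' i ≫ d := by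
    obtain ⟨n, c, hn⟩ := IsCardinalFiltered.multicoequalizer
      (fun i => a i ≫ IsFiltered.leftToMax l l') (fun i => a' i ≫ IsFiltered.rightToMax l l') hι
    exact ⟨n, _, _, fun i => by simpa using hn i⟩
  refine ⟨n, b ≫ c, b' ≫ d, fun i => ?_⟩
  rw [← hl i, ← hl' i, Category.assoc, Category.assoc, ← hn i]
  simp only [appl_map_comp, e]

end Families

/-- The graph of the function symbol `f` in the filtered colimit. -/
def Graph (f : Sg.Func) (m : (i : (Sg.funcArity f).Idx) → Carrier κ F (Sg.funcDom f i))
    (v : Carrier κ F (Sg.funcCod f)) : Prop :=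
  ∃ (j : J) (x : (i : (Sg.funcArity f).Idx) → (F.obj j).obj.carrier (Sg.funcDom f i)),
    (∀ i, m i = mk κ F j (x i)) ∧ ∃ y ∈ (F.obj j).obj.func f x, v = mk κ F j y

omit [Fact κ.IsRegular] [IsCardinalFiltered J κ] in
variable {F} in
lemma mem_func_map {j k : J} (g : j ⟶ k) {f : Sg.Func}
    {x : (i : (Sg.funcArity f).Idx) → (F.obj j).obj.carrier (Sg.funcDom f i)}
    {y : (F.obj j).obj.carrier (Sg.funcCod f)} (h : y ∈ (F.obj j).obj.func f x) :
    appl (F.map g) _ y ∈ (F.obj k).obj.func f fun i => appl (F.map g) _ (x i) :=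
  PStr.Hom.map_func (F.map g).hom f x y h

/-- The stage witnessing the graph may be unrelated to `j`; its arguments agree with `x` at a common
later stage because there are fewer than `κ` of them. -/
lemma Graph.exists_stage {f : Sg.Func} {j : J}
    {x : (i : (Sg.funcArity f).Idx) → (F.obj j).obj.carrier (Sg.funcDom f i)}
    {v : Carrier κ F (Sg.funcCod f)} (h : Graph F f (fun i => mk κ F j (x i)) v) :
    ∃ (k : J) (g : j ⟶ k), ∃ y ∈ (F.obj k).obj.func f fun i => appl (F.map g) _ (x i),
      v = mk κ F k y := by
  obtain ⟨j', x', hx, y, hy, rfl⟩ := h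
  obtain ⟨k, g, g', e⟩ := exists_eq F (Arity.hasCardinalLT_idx _) hx
  exact ⟨k, g, _, by simpa only [e] using mem_func_map g' hy, (mk_map F g' y).symm⟩

lemma Graph.unique {f : Sg.Func}
    {m : (i : (Sg.funcArity f).Idx) → Carrier κ F (Sg.funcDom f i)}
    {v v' : Carrier κ F (Sg.funcCod f)} (h : Graph F f m v) (h' : Graph F f m v') : v = v' := by
  obtain ⟨j, x, hx, y, hy, rfl⟩ := h
  obtain rfl : m = fun i => mk κ F j (x i) := funext hx
  obtain ⟨k, g, y', hy', rfl⟩ := h'.exists_stage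
  rw [Part.mem_unique hy' (mem_func_map g hy), mk_map]

variable (κ) in
/-- The filtered colimit of models, as a partial structure. -/
noncomputable def str : PStr Sg where
  carrier := Carrier κ F
  func f m := ⟨∃ v, Graph F f m v, Exists.choose⟩
  rel R := {m | ∃ (j : J) (x : (i : (Sg.relArity R).Idx) → (F.obj j).obj.carrier (Sg.relDom R i)),
    (∀ i, m i = mk κ F j (x i)) ∧ x ∈ (F.obj j).obj.rel R}

lemma mem_str_func {f : Sg.Func}
    {m : (i : (Sg.funcArity f).Idx) → Carrier κ F (Sg.funcDom f i)}
    {v : Carrier κ F (Sg.funcCod f)} : v ∈ (str κ F).func f m ↔ Graph F f m v :=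
  ⟨fun ⟨h, e⟩ => e ▸ h.choose_spec, fun h => ⟨⟨v, h⟩, Graph.unique F (Exists.choose_spec _) h⟩⟩

variable (κ) in
/-- The canonical homomorphisms to the filtered colimit. -/
noncomputable def incl (j : J) : PStr.Hom (F.obj j).obj (str κ F) where
  toFun _ := mk κ F j
  map_func _ m v hv := (mem_str_func F).2 ⟨j, m, fun _ => rfl, v, hv, rfl⟩
  map_rel _ m hm := ⟨j, m, fun _ => rfl, hm⟩

lemma exists_stage_term {x : Context κ S} {s : S} (τ : Term Sg x s) {j : J}
    (m : (i : x.length.Idx) → (F.obj j).obj.carrier (x.sort i)) {v : Carrier κ F s}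
    (hv : v ∈ τ.interp (str κ F) fun i => mk κ F j (m i)) :
    ∃ (k : J) (g : j ⟶ k), ∃ y ∈ τ.interp (F.obj k).obj fun i => appl (F.map g) _ (m i),
      v = mk κ F k y := by
  induction τ with
  | var i =>
    refine ⟨j, 𝟙 j, m i, ?_, Term.mem_interp_var.1 hv⟩
    simpa using! Term.mem_interp_var.2 rfl
  | app f τ ih =>
    obtain ⟨w, hw, hv⟩ := Term.mem_interp_app.1 hv
    choose k g y hy e using fun i => ih i (hw i)
    obtain ⟨l, a, b, hl⟩ := IsCardinalFiltered.wideSpan g (Arity.hasCardinalLT_idx _)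
    obtain rfl : w = fun i => mk κ F l (appl (F.map (a i)) _ (y i)) :=
      funext fun i => by rw [mk_map, e i]
    obtain ⟨n, c, z, hz, rfl⟩ := Graph.exists_stage F ((mem_str_func F).1 hv)
    refine ⟨n, b ≫ c, z, Term.mem_interp_app.2 ⟨_, fun i => ?_, hz⟩, rfl⟩
    have := (F.map (a i ≫ c)).hom.mem_interp_term _ _ (hy i)
    simp only [← appl_map_comp, ← hl i, Category.assoc] at this ⊢
    simpa only [appl_map_comp] using this

lemma exists_stage_terms {x : Context κ S} {α : Arity κ} {σ : α.Idx → S}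
    (τ : (i : α.Idx) → Term Sg x (σ i)) {j : J}
    (m : (i : x.length.Idx) → (F.obj j).obj.carrier (x.sort i))
    {v : (i : α.Idx) → Carrier κ F (σ i)}
    (hv : ∀ i, v i ∈ (τ i).interp (str κ F) fun i => mk κ F j (m i)) :
    ∃ (k : J) (g : j ⟶ k) (y : (i : α.Idx) → (F.obj k).obj.carrier (σ i)),
      (∀ i, y i ∈ (τ i).interp (F.obj k).obj fun i => appl (F.map g) _ (m i)) ∧
        ∀ i, v i = mk κ F k (y i) := by
  choose k g y hy e using fun i => exists_stage_term F (τ i) m (hv i)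
  obtain ⟨l, a, b, hl⟩ := IsCardinalFiltered.wideSpan g (Arity.hasCardinalLT_idx _)
  refine ⟨l, b, fun i => appl (F.map (a i)) _ (y i), fun i => ?_, fun i => by rw [mk_map, e i]⟩
  have := (F.map (a i)).hom.mem_interp_term _ _ (hy i)
  simpa only [← hl i, appl_map_comp] using this

/-- Each conjunct has its own stage, and fewer than `κ` stages have a common bound under `j`. -/
lemma exists_stage_formula {x : Context κ S} (φ : Formula Sg x) {j : J}
    (m : (i : x.length.Idx) → (F.obj j).obj.carrier (x.sort i))
    (hm : (fun i => mk κ F j (m i)) ∈ φ.interp (str κ F)) :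
    ∃ (k : J) (g : j ⟶ k), (fun i => appl (F.map g) _ (m i)) ∈ φ.interp (F.obj k).obj := by
  have := isFiltered_of_isCardinalFiltered J κ
  induction φ with
  | rel R τ =>
    obtain ⟨v, hv, j', x', hx', hR⟩ := hm
    obtain ⟨k, g, y, hy, e⟩ := exists_stage_terms F τ m hv
    obtain ⟨l, a, b, hl⟩ := exists_eq F (Arity.hasCardinalLT_idx _)
      (fun i => (e i).symm.trans (hx' i))
    refine ⟨l, g ≫ a, fun i => appl (F.map a) _ (y i), fun i => ?_, ?_⟩
    · simpa only [appl_map_comp] using! (F.map a).hom.mem_interp_term _ _ (hy i)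
    · simpa only [hl] using! (F.map b).hom.map_rel R _ hR
  | eq τ τ' =>
    obtain ⟨v, hv, hv'⟩ := hm
    obtain ⟨k, g, y, hy, rfl⟩ := exists_stage_term F τ m hv
    obtain ⟨k', g', y', hy', e⟩ := exists_stage_term F τ' m hv'
    obtain ⟨l, a, b, hl⟩ := mk_eq_mk F e
    -- The two routes from `j` to `l` may differ, but `m` has to be transported along a single one.
    obtain ⟨n, c, hn⟩ : ∃ (n : J) (c : l ⟶ n), (g ≫ a) ≫ c = (g' ≫ b) ≫ c :=
      ⟨_, IsFiltered.coeqHom _ _, IsFiltered.coeq_condition _ _⟩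
    refine ⟨n, g ≫ a ≫ c, appl (F.map (a ≫ c)) _ y, ?_, ?_⟩
    · simpa only [appl_map_comp] using! (F.map (a ≫ c)).hom.mem_interp_term _ _ hy
    · have e₁ : appl (F.map (a ≫ c)) _ y = appl (F.map (b ≫ c)) _ y' := by
        rw [appl_map_comp, hl, ← appl_map_comp]
      rw [← Category.assoc, hn, Category.assoc, e₁]
      simpa only [appl_map_comp] using! (F.map (b ≫ c)).hom.mem_interp_term _ _ hy'
  | top => exact ⟨j, 𝟙 j, trivial⟩
  | conj α φ ih =>
    replace hm := Set.mem_iInter.1 hm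
    choose k g h using fun i => ih i (hm i)
    obtain ⟨l, a, b, hl⟩ := IsCardinalFiltered.wideSpan g (Arity.hasCardinalLT_idx _)
    refine ⟨l, b, Set.mem_iInter.2 fun i => ?_⟩
    simpa only [← hl i, appl_map_comp] using! (F.map (a i)).hom.mem_interp_formula _ _ (h i)

/-- A tuple over a context lives at one stage; the premise becomes true at a later stage, which is a
model, and the conclusion is pushed forward. -/
lemma isModel_str : T.isModel (str κ F) := fun σ hσ m hm => by
  obtain ⟨j, x, rfl⟩ := exists_lift F (Arity.hasCardinalLT_idx _) m
  obtain ⟨k, g, h⟩ := exists_stage_formula F _ x hm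
  have := (incl κ F k).mem_interp_formula _ _ ((F.obj k).property σ hσ h)
  simpa only [incl, mk_map] using! this

variable (κ) in
/-- The colimit cocone over a `κ`-filtered diagram of models. -/
noncomputable def cocone : Cocone F where
  pt := ⟨str κ F, isModel_str F⟩
  ι :=
    { app j := ObjectProperty.homMk (incl κ F j)
      naturality _ _ g := hom_ext' fun _ x => mk_map F g x }

variable {F} in
/-- The underlying functions of the morphism from the filtered colimit to another cocone. -/
def descFun (c : Cocone F) (s : S) : Carrier κ F s → c.pt.obj.carrier s :=
  Quotient.lift (fun x => appl (c.ι.app x.1) s x.2) fun x y ⟨k, f, g, h⟩ => by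
    rw [← c.w f, ← c.w g, appl_comp, appl_comp, h]

variable (κ) in
/-- The universal property of the filtered colimit of models. -/
noncomputable def isColimitCocone : IsColimit (cocone κ F) where
  desc c := ObjectProperty.homMk
    { toFun := descFun c
      map_func f m v hv := by
        obtain ⟨j, x, hx, y, hy, rfl⟩ := (mem_str_func F).1 hv
        obtain rfl : m = fun i => mk κ F j (x i) := funext hx
        exact (c.ι.app j).hom.map_func f x y hy
      map_rel R m := by
        rintro ⟨j, x, hx, hR⟩
        obtain rfl : m = fun i => mk κ F j (x i) := funext hx
        exact (c.ι.app j).hom.map_rel R x hR }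
  fac c j := rfl
  uniq c m hm := hom_ext' fun s x => by
    induction x using Quotient.inductionOn with | _ x =>
    exact congrArg (fun h => appl h s x.2) (hm x.1)

end FilteredColimit

/-! ### A strong generator of presentable models -/

section Generator

variable [Fact κ.IsRegular]

open FilteredColimit in
-- Morphisms out of the representing model are tuples satisfying `φ`. Such a tuple in a `κ`-filtered
-- colimit, and an equality of two of them, already occur at a stage.
instance {x : Context κ S} (φ : Formula Sg x) : IsCardinalPresentable (representing T φ) κ where
  preservesColimitOfShape J _ _ := ⟨fun {F} => by
    have := isFiltered_of_isCardinalFiltered J κ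
    refine preservesColimit_of_preserves_colimit_cocone (isColimitCocone κ F)
      (Types.FilteredColimit.isColimitOf' _ _ (fun a => ?_) fun j a b h => ?_)
    · change representing T φ ⟶ _ at a
      obtain ⟨j, y, hy⟩ := exists_lift F (Arity.hasCardinalLT_idx _)
        (fun i => appl a _ (generic T φ i))
      obtain ⟨k, g, hk⟩ := exists_stage_formula F φ y (hy ▸ apply_generic_mem a)
      refine ⟨k, fromRepresenting _ hk, representing_hom_ext fun i => ?_⟩
      exact (congrFun hy i).trans (mk_map F g (y i)).symm
    · change representing T φ ⟶ _ at a b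
      obtain ⟨k, f, g, e⟩ := exists_eq F (Arity.hasCardinalLT_idx _)
        (x := fun i => appl a _ (generic T φ i)) (y := fun i => appl b _ (generic T φ i))
        fun i => congrArg (fun h => appl h _ (generic T φ i)) h
      -- The injectivity criterion wants one transition map, whereas `f` and `g` may differ.
      refine ⟨IsFiltered.coeq f g, f ≫ IsFiltered.coeqHom f g, representing_hom_ext fun i => ?_⟩
      change appl (a ≫ F.map _) _ _ = appl (b ≫ F.map _) _ _
      rw [appl_comp, appl_comp, appl_map_comp, e, ← appl_map_comp, IsFiltered.coeq_condition]⟩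

variable (T) in
/-- The models which represent formulas in context. -/
def representingModels : ObjectProperty (PMod T) :=
  .ofObj fun φ : Σ x : Context κ S, Formula Sg x => representing T φ.2

omit [Fact κ.IsRegular] in
lemma representingModels_representing {x : Context κ S} (φ : Formula Sg x) :
    representingModels T (representing T φ) :=
  ObjectProperty.ofObj_apply (fun φ : Σ x : Context κ S, Formula Sg x => representing T φ.2) ⟨x, φ⟩

/-- Elements of sort `s` correspond to morphisms from a representing model. -/
lemma exists_representing_sort (T : Theory Sg) (s : S) :
    ∃ (G : PMod T) (_ : representingModels T G) (g : G.obj.carrier s),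
      ∀ (M : PMod T) (x : M.obj.carrier s), ∃ a : G ⟶ M, appl a s g = x := by
  obtain ⟨α, ⟨e⟩⟩ := exists_arity_one κ
  let x : Context κ S := ⟨α, fun _ => s⟩
  exact ⟨representing T (.top : Formula Sg x), representingModels_representing _,
    generic T .top (e.symm ⟨⟩),
    fun M y => ⟨fromRepresenting (fun _ => y) trivial, fromRepresenting_generic _ _ _⟩⟩

lemma injective_of_mono {M N : PMod T} (i : M ⟶ N) [Mono i] (s : S) :
    Function.Injective (appl i s) := fun x y h => by
  obtain ⟨α, ⟨e⟩⟩ := exists_arity_one κ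
  let c : Context κ S := ⟨α, fun _ => s⟩
  let r (z : M.obj.carrier s) : representing T (.top : Formula Sg c) ⟶ M :=
    fromRepresenting (fun _ => z) trivial
  have : r x = r y := by
    rw [← cancel_mono i]
    exact representing_hom_ext fun _ => h
  exact congrArg (fun a => appl a s (generic T .top (e.symm ⟨⟩))) this

-- Bijectivity alone does not suffice: definedness and relations must also be reflected for the
-- inverse to be a homomorphism.
omit [Fact κ.IsRegular] in
lemma isIso_of_bijective {M N : PMod T} (i : M ⟶ N) (hi : ∀ s, Function.Bijective (appl i s))
    (hf : ∀ f m v, appl i _ v ∈ N.obj.func f (fun k => appl i _ (m k)) → v ∈ M.obj.func f m)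
    (hR : ∀ R m, (fun k => appl i _ (m k)) ∈ N.obj.rel R → m ∈ M.obj.rel R) : IsIso i := by
  let e (s : S) := Equiv.ofBijective _ (hi s)
  have he (s y) : appl i s ((e s).symm y) = y := (e s).apply_symm_apply y
  refine ⟨ObjectProperty.homMk
    { toFun s := (e s).symm
      map_func f m v hv := hf _ _ _ (by simpa only [he] using hv)
      map_rel R m hm := hR _ _ (by simpa only [he] using hm) }, ?_, ?_⟩
  · exact hom_ext' fun s x => (e s).symm_apply_apply x
  · exact hom_ext' fun s x => he s x

/-- If all morphisms from representing models factor through a monomorphism, it reflects every Horn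
formula. Lifting for `⊤` gives surjectivity; lifting for the formulas `f(x) = f(x)` and `R(x)`
reflects the structure. -/
lemma isStrongGenerator_representingModels : (representingModels T).IsStrongGenerator := by
  refine ObjectProperty.isStrongGenerator_iff.2 ⟨fun M N f g h => hom_ext' fun s x => ?_,
    fun M N i _ h => ?_⟩
  · obtain ⟨G, hG, y, hy⟩ := exists_representing_sort T s
    obtain ⟨a, rfl⟩ := hy M x
    exact congrArg (fun b => appl b s y) (h G hG a)
  · have lift {x : Context κ S} (φ : Formula Sg x)
        (m : (k : x.length.Idx) → M.obj.carrier (x.sort k))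
        (hm : (fun k => appl i _ (m k)) ∈ φ.interp N.obj) : m ∈ φ.interp M.obj := by
      obtain ⟨a, ha⟩ := h _ (representingModels_representing φ) (fromRepresenting _ hm)
      have : m = fun k => appl a _ (generic T φ k) := funext fun k => injective_of_mono i _
        (congrArg (fun b => appl b _ (generic T φ k)) ha).symm
      rw [this]
      exact apply_generic_mem a
    refine isIso_of_bijective i (fun s => ⟨injective_of_mono i s, fun y => ?_⟩) ?_ ?_
    · obtain ⟨G, hG, g, hg⟩ := exists_representing_sort T s
      obtain ⟨b, rfl⟩ := hg N y
      obtain ⟨a, rfl⟩ := h G hG b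
      exact ⟨appl a s g, rfl⟩
    · intro f m v hv
      let x : Context κ S := ⟨Sg.funcArity f, Sg.funcDom f⟩
      let τ : Term Sg x (Sg.funcCod f) := .app f fun k => .var (x := x) k
      have hτ {P : PMod T} {m v} : v ∈ τ.interp P.obj m ↔ v ∈ P.obj.func f m :=
        Term.mem_interp_app.trans ⟨fun ⟨w, hw, hv⟩ => by
          obtain rfl : w = m := funext fun k => Term.mem_interp_var.1 (hw k)
          exact hv, fun hv => ⟨m, fun k => Term.mem_interp_var.2 rfl, hv⟩⟩
      -- The equation `τ = τ` expresses that `f` is defined at the tuple; injectivity then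
      -- identifies the value.
      obtain ⟨v', hv', -⟩ := lift (.eq τ τ) m ⟨_, hτ.2 hv, hτ.2 hv⟩
      rw [hτ] at hv'
      convert hv'
      exact injective_of_mono i _ (Part.mem_unique hv (i.hom.map_func f _ _ hv'))
    · intro R m hm
      let x : Context κ S := ⟨Sg.relArity R, Sg.relDom R⟩
      obtain ⟨v, hv, hR⟩ := lift (.rel R fun k => .var (x := x) k) m
        ⟨_, fun k => Term.mem_interp_var.2 rfl, hm⟩
      obtain rfl : v = m := funext fun k => Term.mem_interp_var.1 (hv k)
      exact hR

/-- The category of models of a `κ`-ary partial Horn theory is locally `κ`-presentable. -/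
instance : IsCardinalLocallyPresentable (PMod T) κ := by
  refine (IsCardinalLocallyPresentable.iff_exists_isStrongGenerator _ _).2
    ⟨representingModels T, ?_, isStrongGenerator_representingModels, ?_⟩
  · dsimp only [representingModels]
    infer_instance
  · rintro _ ⟨φ⟩
    exact inferInstanceAs (IsCardinalPresentable (representing T φ.2) κ)

end Generator

end PartialHorn

/-! ### The nerve of a small subcategory and its theory -/

namespace PartialHorn

open Limits

/-- An element of `Arity κ` with exactly one index. -/
noncomputable def oneArity (κ : Cardinal.{w}) [Fact κ.IsRegular] : Arity κ :=
  (exists_arity_one κ).choose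

/-- The index of `oneArity κ`. -/
noncomputable def oneIdx (κ : Cardinal.{w}) [Fact κ.IsRegular] : (oneArity κ).Idx :=
  (exists_arity_one κ).choose_spec.some.symm ⟨⟩

lemma eq_oneIdx {κ : Cardinal.{w}} [Fact κ.IsRegular] (k : (oneArity κ).Idx) : k = oneIdx κ :=
  (exists_arity_one κ).choose_spec.some.injective rfl

section Nerve

variable {κ : Cardinal.{w}} {D : Type w} [SmallCategory D]
  {A : Type (w + 1)} [Category.{w} A] (i : D ⥤ A)

variable (κ) in
/-- The function symbols of the signature of a small subcategory `i : D ⥤ A`: a jointly epimorphic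
family `dom k ⟶ pt` and a morphism `cod ⟶ pt`. They stand for the partial operation which sends a
family `dom k ⟶ X` to the composition `cod ⟶ pt ⟶ X`, where `pt ⟶ X` extends the given family. -/
structure ConeOp where
  arity : Arity κ
  dom : arity.Idx → D
  pt : D
  cod : D
  leg (k : arity.Idx) : dom k ⟶ pt
  out : cod ⟶ pt
  jointlyEpi {X : A} (h h' : i.obj pt ⟶ X)
    (e : ∀ k, i.map (leg k) ≫ h = i.map (leg k) ≫ h') : h = h'

variable (κ) in
/-- The signature with sorts the objects of `D` and function symbols `ConeOp κ i`. -/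
def coneSignature : Signature κ D where
  Func := ConeOp κ i
  funcArity := ConeOp.arity
  funcDom := ConeOp.dom
  funcCod := ConeOp.cod
  Rel := PEmpty
  relArity R := R.elim
  relDom R := R.elim

variable (κ) in
/-- The partial structure formed by the morphisms from objects of `D` to `X`. -/
noncomputable def nerveStr (X : A) : PStr (coneSignature κ i) where
  carrier d := i.obj d ⟶ X
  func (g : ConeOp κ i) x := ⟨∃ h : i.obj g.pt ⟶ X, ∀ k, i.map (g.leg k) ≫ h = x k,
    fun e => i.map g.out ≫ e.choose⟩
  rel R := R.elim

variable {i}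

/-- Joint epimorphy makes the extension unique, so the choice in `nerveStr` does not matter. -/
lemma mem_nerveStr_func {X : A} {g : ConeOp κ i} {x : (k : g.arity.Idx) → (i.obj (g.dom k) ⟶ X)}
    {v : i.obj g.cod ⟶ X} :
    v ∈ (nerveStr κ i X).func g x ↔
      ∃ h : i.obj g.pt ⟶ X, (∀ k, i.map (g.leg k) ≫ h = x k) ∧ i.map g.out ≫ h = v := by
  constructor
  · rintro ⟨e, rfl⟩
    exact ⟨_, e.choose_spec, rfl⟩
  · rintro ⟨h, hx, rfl⟩
    refine ⟨⟨h, hx⟩, congrArg (i.map g.out ≫ ·) (g.jointlyEpi _ _ fun k => ?_)⟩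
    rw [hx k]
    exact Exists.choose_spec (p := fun h : i.obj g.pt ⟶ X => ∀ k, i.map (g.leg k) ≫ h = x k) _ k

variable (κ i)

/-- The theory of all sequents which are valid for the morphisms to any object of `A`. -/
def nerveTheory : Theory (coneSignature κ i) := {σ | ∀ X : A, σ.Valid (nerveStr κ i X)}

/-- The functor which sends `X` to the model formed by the morphisms from objects of `D` to `X`. -/
noncomputable def nerve : A ⥤ PMod (nerveTheory κ i) where
  obj X := ⟨nerveStr κ i X, fun _ hσ => hσ X⟩
  map {X Y} f := ObjectProperty.homMk
    { toFun _ x := x ≫ f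
      map_func g x v hv := by
        obtain ⟨h, hx, rfl⟩ := mem_nerveStr_func.1 hv
        exact mem_nerveStr_func.2 ⟨h ≫ f,
          fun k => (Category.assoc _ _ _).symm.trans (congrArg (· ≫ f) (hx k)),
          (Category.assoc _ _ _).symm⟩
      map_rel R := R.elim }
  map_id X := hom_ext' fun _ x => Category.comp_id x
  map_comp f g := hom_ext' fun _ x => (Category.assoc x f g).symm

variable {κ i}

variable [Fact κ.IsRegular]

variable (κ i) in
/-- The unary operation given by a morphism of `D`. -/
noncomputable def unaryOp {d d' : D} (u : d' ⟶ d) : ConeOp κ i where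
  arity := oneArity κ
  dom _ := d
  pt := d
  cod := d'
  leg _ := 𝟙 d
  out := u
  jointlyEpi h h' e := by simpa using e (oneIdx κ)

lemma mem_nerveStr_unaryOp {X : A} {d d' : D} {u : d' ⟶ d} {x : i.obj d ⟶ X}
    {v : i.obj d' ⟶ X} :
    v ∈ (nerveStr κ i X).func (unaryOp κ i u) (fun _ => x) ↔ v = i.map u ≫ x := by
  refine mem_nerveStr_func.trans ⟨?_, ?_⟩
  · rintro ⟨(h : i.obj d ⟶ X), hx, rfl⟩
    have hx' : i.map (𝟙 d) ≫ h = x := hx (oneIdx κ)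
    rw [i.map_id, Category.id_comp] at hx'
    exact congrArg (i.map u ≫ ·) hx'
  · rintro rfl
    exact ⟨x, fun k => by simp [unaryOp], rfl⟩

/-- The term given by the action of a morphism of `D` on a term. -/
noncomputable def unaryTerm {c : Context κ D} {d d' : D} (u : d' ⟶ d)
    (τ : Term (coneSignature κ i) c d) : Term (coneSignature κ i) c d' :=
  .app (Sg := coneSignature κ i) (unaryOp κ i u) fun _ => τ

lemma mem_interp_unaryTerm {M : PStr (coneSignature κ i)} {c : Context κ D} {d d' : D} {u : d' ⟶ d}
    {τ : Term (coneSignature κ i) c d} {m : (k : c.length.Idx) → M.carrier (c.sort k)}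
    {v : M.carrier d'} : v ∈ (unaryTerm u τ).interp M m ↔
      ∃ w ∈ τ.interp M m, v ∈ M.func (unaryOp κ i u) fun _ => w := by
  refine Term.mem_interp_app.trans ⟨?_, fun ⟨w, hw, hv⟩ => ⟨fun _ => w, fun _ => hw, hv⟩⟩
  rintro ⟨(w : (oneArity κ).Idx → M.carrier d), hw, hv⟩
  have e : w = fun _ => w (oneIdx κ) := funext fun k => congrArg w (eq_oneIdx k)
  exact ⟨w (oneIdx κ), hw (oneIdx κ), Eq.mp (congrArg
    (fun z : (oneArity κ).Idx → M.carrier d => v ∈ M.func (unaryOp κ i u) z) e) hv⟩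

/-- The context with a single variable. -/
noncomputable def oneContext (d : D) : Context κ D := ⟨oneArity κ, fun _ => d⟩

/-- The variable of `oneContext d`. -/
noncomputable def oneVar (d : D) : Term (coneSignature κ i) (oneContext d) d :=
  .var (x := oneContext d) (oneIdx κ)

lemma mem_interp_oneVar {M : PStr (coneSignature κ i)} {d : D}
    {m : (oneArity κ).Idx → M.carrier d} {v : M.carrier d} :
    v ∈ (oneVar d).interp M m ↔ v = m (oneIdx κ) :=
  Term.mem_interp_var

/-! ### Models of the nerve theory as presheaves -/

variable (M : PMod (nerveTheory κ i))

-- An implication true in all nerves is an axiom by definition. Facts about arbitrary models are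
-- obtained by checking them on nerves.
omit [Fact κ.IsRegular] in
lemma mem_interp_of_nerve {c : Context κ D} {φ ψ : Formula (coneSignature κ i) c}
    (h : ∀ X : A, φ.interp (nerveStr κ i X) ⊆ ψ.interp (nerveStr κ i X))
    {m : (k : c.length.Idx) → M.obj.carrier (c.sort k)} (hm : m ∈ φ.interp M.obj) :
    m ∈ ψ.interp M.obj :=
  M.property ⟨c, φ, ψ⟩ h hm

lemma exists_mem_unaryOp {d d' : D} (u : d' ⟶ d) (x : M.obj.carrier d) :
    ∃ v, v ∈ M.obj.func (unaryOp κ i u) fun _ => x := by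
  obtain ⟨v, hv, -⟩ := mem_interp_of_nerve M (c := oneContext d) (φ := .top)
    (ψ := .eq (unaryTerm u (oneVar d)) (unaryTerm u (oneVar d))) (m := fun _ => x)
    (fun X m _ => by
      have : i.map u ≫ m (oneIdx κ) ∈ (unaryTerm u (oneVar d)).interp (nerveStr κ i X) m :=
        mem_interp_unaryTerm.2 ⟨_, mem_interp_oneVar.2 rfl, mem_nerveStr_unaryOp.2 rfl⟩
      exact ⟨_, this, this⟩) trivial
  obtain ⟨w, hw, hv'⟩ := mem_interp_unaryTerm.1 hv
  obtain rfl := mem_interp_oneVar.1 hw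
  exact ⟨v, hv'⟩

/-- The action of the morphisms of `D` on a model. -/
noncomputable def act {d d' : D} (u : d' ⟶ d) (x : M.obj.carrier d) : M.obj.carrier d' :=
  (exists_mem_unaryOp M u x).choose

variable {M}

lemma mem_func_unaryOp {d d' : D} {u : d' ⟶ d} {x : M.obj.carrier d} {v : M.obj.carrier d'} :
    v ∈ M.obj.func (unaryOp κ i u) (fun _ => x) ↔ v = act M u x :=
  ⟨fun h => Part.mem_unique h (exists_mem_unaryOp M u x).choose_spec,
    fun h => h ▸ (exists_mem_unaryOp M u x).choose_spec⟩

lemma mem_unaryTerm {c : Context κ D} {d d' : D} {u : d' ⟶ d}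
    {τ : Term (coneSignature κ i) c d} {m : (k : c.length.Idx) → M.obj.carrier (c.sort k)}
    {v : M.obj.carrier d'} : v ∈ (unaryTerm u τ).interp M.obj m ↔
      ∃ w ∈ τ.interp M.obj m, v = act M u w := by
  simp only [mem_interp_unaryTerm, mem_func_unaryOp]

lemma act_nerve {X : A} {d d' : D} (u : d' ⟶ d) (x : i.obj d ⟶ X) :
    act ((nerve κ i).obj X) u x = i.map u ≫ x :=
  (mem_func_unaryOp (M := (nerve κ i).obj X).1 (mem_nerveStr_unaryOp.2 rfl)).symm

lemma act_hom {N : PMod (nerveTheory κ i)} (f : M ⟶ N) {d d' : D} (u : d' ⟶ d)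
    (x : M.obj.carrier d) : appl f d' (act M u x) = act N u (appl f d x) :=
  mem_func_unaryOp.1 (f.hom.map_func (unaryOp κ i u) _ _ (mem_func_unaryOp.2 rfl))

/-- Equations between elements of a nerve which are given by terms hold in all models. -/
lemma eq_of_nerve {d d' : D} {τ τ' : Term (coneSignature κ i) (oneContext d) d'}
    (h : ∀ (X : A) (x : i.obj d ⟶ X), ∃ v, v ∈ τ.interp ((nerve κ i).obj X).obj (fun _ => x) ∧
      v ∈ τ'.interp ((nerve κ i).obj X).obj fun _ => x) (x : M.obj.carrier d) :
    ∃ v, v ∈ τ.interp M.obj (fun _ => x) ∧ v ∈ τ'.interp M.obj fun _ => x :=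
  mem_interp_of_nerve M (φ := .top) (ψ := .eq τ τ') (m := fun _ => x) (fun X (m : _ → (i.obj d ⟶ X)) _ => by
    have e : (fun _ => m (oneIdx κ)) = m := funext fun k => congrArg m (eq_oneIdx k).symm
    exact e ▸ h X (m (oneIdx κ))) trivial

lemma act_id {d : D} (x : M.obj.carrier d) : act M (𝟙 d) x = x := by
  obtain ⟨v, hv, hv'⟩ := eq_of_nerve (M := M) (τ := unaryTerm (𝟙 d) (oneVar d)) (τ' := oneVar d)
    (fun X x => ⟨x, mem_unaryTerm.2 ⟨x, mem_interp_oneVar.2 rfl, by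
      rw [act_nerve, i.map_id, Category.id_comp]⟩, mem_interp_oneVar.2 rfl⟩) x
  obtain ⟨w, hw, rfl⟩ := mem_unaryTerm.1 hv
  obtain rfl := mem_interp_oneVar.1 hw
  exact mem_interp_oneVar.1 hv'

lemma act_comp {d d' d'' : D} (u : d'' ⟶ d') (t : d' ⟶ d) (x : M.obj.carrier d) :
    act M (u ≫ t) x = act M u (act M t x) := by
  obtain ⟨v, hv, hv'⟩ := eq_of_nerve (M := M) (τ := unaryTerm (u ≫ t) (oneVar d))
    (τ' := unaryTerm u (unaryTerm t (oneVar d)))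
    (fun X x => ⟨_, mem_unaryTerm.2 ⟨x, mem_interp_oneVar.2 rfl, rfl⟩,
      mem_unaryTerm.2 ⟨_, mem_unaryTerm.2 ⟨x, mem_interp_oneVar.2 rfl, rfl⟩,
        (act_nerve _ _).trans <| ((congrArg (· ≫ x) (i.map_comp u t)).trans
          (Category.assoc _ _ _)).trans
            ((congrArg (act _ u) (act_nerve t x)).trans (act_nerve u _)).symm⟩⟩) x
  obtain ⟨w, hw, rfl⟩ := mem_unaryTerm.1 hv
  obtain rfl := mem_interp_oneVar.1 hw
  obtain ⟨w', hw', e⟩ := mem_unaryTerm.1 hv'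
  obtain ⟨w, hw, rfl⟩ := mem_unaryTerm.1 hw'
  obtain rfl := mem_interp_oneVar.1 hw
  exact e

/-- In a nerve, `n` itself extends the family of its restrictions along the legs. With
`exists_of_mem_func`, this recovers every operation from the action of `D`. -/
lemma act_out_mem (g : ConeOp κ i) (n : M.obj.carrier g.pt) :
    act M g.out n ∈ M.obj.func g fun k => act M (g.leg k) n := by
  obtain ⟨v, hv, hv'⟩ := eq_of_nerve (M := M) (τ := unaryTerm g.out (oneVar g.pt))
    (τ' := .app (Sg := coneSignature κ i) g fun k => unaryTerm (g.leg k) (oneVar g.pt))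
    (fun X x => ⟨_, mem_unaryTerm.2 ⟨x, mem_interp_oneVar.2 rfl, rfl⟩,
      Term.mem_interp_app.2 ⟨_, fun k => mem_unaryTerm.2 ⟨x, mem_interp_oneVar.2 rfl, rfl⟩, by
        exact mem_nerveStr_func.2 ⟨x, fun k => (act_nerve _ _).symm, (act_nerve _ _).symm⟩⟩⟩) n
  obtain ⟨w, hw, rfl⟩ := mem_unaryTerm.1 hv
  obtain rfl := mem_interp_oneVar.1 hw
  obtain ⟨x, hx, h⟩ := Term.mem_interp_app.1 hv'
  convert! h using 2
  funext k
  obtain ⟨w, hw, e⟩ := mem_unaryTerm.1 (hx k)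
  obtain rfl := mem_interp_oneVar.1 hw
  exact e.symm

section

variable (g : ConeOp κ i)

/-- The generic context for the operation `g`. -/
def opContext : Context κ D := ⟨g.arity, g.dom⟩

/-- The operation `g`, applied to the variables of its generic context. -/
def opTerm : Term (coneSignature κ i) (opContext g) g.cod :=
  .app (Sg := coneSignature κ i) g fun k => .var (x := opContext g) k

omit [Fact κ.IsRegular] in
lemma mem_opTerm {M : PStr (coneSignature κ i)} {m : (k : g.arity.Idx) → M.carrier (g.dom k)}
    {v : M.carrier g.cod} : v ∈ (opTerm g).interp M m ↔ v ∈ M.func g m := by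
  refine Term.mem_interp_app.trans ⟨fun ⟨w, hw, hv⟩ => ?_, fun hv =>
    ⟨m, fun k => Term.mem_interp_var.2 rfl, hv⟩⟩
  obtain rfl : w = m := funext fun k => Term.mem_interp_var.1 (hw k)
  exact hv

/-- The operation whose value is the extension of the given family along the legs of `g`. -/
def extOp : ConeOp κ i where
  __ := g
  cod := g.pt
  out := 𝟙 g.pt

omit [Fact κ.IsRegular] in
lemma mem_nerveStr_extOp {X : A} {x : (k : g.arity.Idx) → (i.obj (g.dom k) ⟶ X)}
    {h : i.obj g.pt ⟶ X} :
    h ∈ (nerveStr κ i X).func (extOp g) x ↔ ∀ k, i.map (g.leg k) ≫ h = x k := by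
  have e (h : i.obj g.pt ⟶ X) : i.map (𝟙 g.pt) ≫ h = h := by
    rw [i.map_id, Category.id_comp]
  refine mem_nerveStr_func.trans ⟨?_, fun hx => ⟨h, hx, e h⟩⟩
  rintro ⟨h', hx, rfl⟩ k
  exact (congrArg (i.map (g.leg k) ≫ ·) (e h')).trans (hx k)

variable {g} in
-- Horn formulas have no existential quantifier, but the extension is named by a term, the operation
-- `extOp g`; its defining equations then become Horn sequents.
lemma exists_of_mem_func {x : (k : g.arity.Idx) → M.obj.carrier (g.dom k)}
    {v : M.obj.carrier g.cod} (hv : v ∈ M.obj.func g x) :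
    ∃ n : M.obj.carrier g.pt, (∀ k, act M (g.leg k) n = x k) ∧ act M g.out n = v := by
  have hφ : x ∈ (Formula.eq (opTerm g) (opTerm g)).interp M.obj :=
    ⟨v, (mem_opTerm g).2 hv, (mem_opTerm g).2 hv⟩
  let τ : Term (coneSignature κ i) (opContext g) g.pt := opTerm (extOp g)
  obtain ⟨v', hv₁, hv₂⟩ := mem_interp_of_nerve M (φ := .eq (opTerm g) (opTerm g))
    (ψ := .eq (unaryTerm g.out τ) (opTerm g)) (fun X m ⟨v, hv, _⟩ => by
      obtain ⟨h, hm, rfl⟩ := mem_nerveStr_func.1 ((mem_opTerm g).1 hv)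
      exact ⟨_, mem_interp_unaryTerm.2 ⟨h, (mem_opTerm (extOp g)).2
        ((mem_nerveStr_extOp g).2 hm), mem_nerveStr_unaryOp.2 rfl⟩, hv⟩) hφ
  have hl := mem_interp_of_nerve M (φ := .eq (opTerm g) (opTerm g))
    (ψ := .conj g.arity fun k => .eq (unaryTerm (g.leg k) τ) (.var (x := opContext g) k))
    (fun X m ⟨v, hv, _⟩ => Set.mem_iInter.2 fun k => by
      obtain ⟨h, hm, rfl⟩ := mem_nerveStr_func.1 ((mem_opTerm g).1 hv)
      exact ⟨m k, mem_interp_unaryTerm.2 ⟨h, (mem_opTerm (extOp g)).2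
        ((mem_nerveStr_extOp g).2 hm), mem_nerveStr_unaryOp.2 (hm k).symm⟩,
        Term.mem_interp_var.2 rfl⟩) hφ
  obtain ⟨n, hn, rfl⟩ := mem_unaryTerm.1 hv₁
  refine ⟨n, fun k => ?_, Part.mem_unique ((mem_opTerm g).1 hv₂) hv⟩
  obtain ⟨y, hy, hy'⟩ := Set.mem_iInter.1 hl k
  obtain ⟨n', hn', rfl⟩ := mem_unaryTerm.1 hy
  obtain rfl := Part.mem_unique hn hn'
  exact Term.mem_interp_var.1 hy'

end

/-- A compatible family of elements, indexed by a `κ`-small diagram in `D` with a colimit in `A`,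
comes from an element over the colimit. -/
lemma exists_act_eq {K : Type w} [SmallCategory K] (hK : HasCardinalLT (Arrow K) κ) {G : K ⥤ D}
    {c : Cocone G} (hc : IsColimit (i.mapCocone c)) (x : (k : K) → M.obj.carrier (G.obj k))
    (hx : ∀ {k k' : K} (f : k ⟶ k'), act M (G.map f) (x k') = x k) :
    ∃ n : M.obj.carrier c.pt, ∀ k, act M (c.ι.app k) n = x k := by
  -- Objects of `K` index the variables and arrows of `K` index the compatibility equations, so both
  -- must be enumerated by arities.
  obtain ⟨α, ⟨e⟩⟩ := Arity.exists_equiv (hasCardinalLT_of_hasCardinalLT_arrow hK)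
  obtain ⟨β, ⟨b⟩⟩ := Arity.exists_equiv (X := Σ p : α.Idx × α.Idx, (e p.1 ⟶ e p.2))
    (hK.of_injective (fun p => Arrow.mk p.2) (by
      rintro ⟨⟨a, a'⟩, f⟩ ⟨⟨b, b'⟩, f'⟩ h
      obtain rfl := e.injective (congrArg Comma.left h)
      obtain rfl := e.injective (congrArg Comma.right h)
      obtain rfl : f = f' := (Arrow.mk_inj _ _).1 h
      rfl))
  -- The colimit legs are jointly epic in `A`. Only the definedness of `g` will matter, so its
  -- output is taken to be trivial.
  let g : ConeOp κ i :=
    { arity := α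
      dom a := G.obj (e a)
      pt := c.pt
      cod := c.pt
      leg a := c.ι.app (e a)
      out := 𝟙 _
      jointlyEpi h h' H := hc.hom_ext fun k => by
        obtain ⟨a, rfl⟩ := e.surjective k
        exact H a }
  let φ : Formula (coneSignature κ i) (opContext g) := .conj β fun j =>
    .eq (unaryTerm (G.map (b j).2) (.var (x := opContext g) (b j).1.2))
      (.var (x := opContext g) (b j).1.1)
  have hφ : (fun a => x (e a)) ∈ φ.interp M.obj := Set.mem_iInter.2 fun j =>
    ⟨_, mem_unaryTerm.2 ⟨_, Term.mem_interp_var.2 rfl, (hx (b j).2).symm⟩,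
      Term.mem_interp_var.2 rfl⟩
  -- In a nerve, a tuple satisfying `φ` is a cocone over `G ⋙ i`, and the induced morphism shows
  -- that `g` is defined.
  obtain ⟨v, hv, -⟩ := mem_interp_of_nerve M (ψ := .eq (opTerm g) (opTerm g)) (fun X m hm => by
    let y := Equiv.piCongrLeft (fun k => (i.obj (G.obj k) ⟶ X)) e m
    have hy (a) : y (e a) = m a := Equiv.piCongrLeft_apply_apply _ _ _ _
    let s : Cocone (G ⋙ i) :=
      { pt := X
        ι :=
          { app := y
            naturality k k' f := by
              obtain ⟨a, rfl⟩ := e.surjective k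
              obtain ⟨a', rfl⟩ := e.surjective k'
              obtain ⟨j, hj⟩ := b.surjective ⟨(a, a'), f⟩
              obtain ⟨v, hv, hv'⟩ := Set.mem_iInter.1 hm j
              obtain ⟨w, hw, hv⟩ := mem_interp_unaryTerm.1 hv
              replace hv := mem_nerveStr_unaryOp.1 hv
              obtain rfl := Term.mem_interp_var.1 hw
              have h := hv.symm.trans (Term.mem_interp_var.1 hv')
              rw [hj] at h
              have h' : i.map (G.map f) ≫ m a' = m a := by simpa using h
              exact (congrArg (i.map (G.map f) ≫ ·) (hy a')).trans
                (h'.trans ((hy a).symm.trans (Category.comp_id _).symm)) } }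
    have : hc.desc s ∈ (opTerm g).interp (nerveStr κ i X) m := (mem_opTerm g).2
      (mem_nerveStr_func.2 ⟨hc.desc s, fun a => (hc.fac s (e a)).trans (hy a), by simp [g]⟩)
    exact ⟨_, this, this⟩) hφ
  obtain ⟨n, hn, -⟩ := exists_of_mem_func ((mem_opTerm g).1 hv)
  refine ⟨n, fun k => ?_⟩
  obtain ⟨a, rfl⟩ := e.surjective k
  exact hn a

/-! ### Realization of a model as a filtered colimit -/

variable (M) in
/-- The category of elements of a model. -/
structure Elt where
  obj : D
  elt : M.obj.carrier obj

noncomputable instance : SmallCategory (Elt M) where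
  Hom p q := {f : p.obj ⟶ q.obj // act M f q.elt = p.elt}
  id p := ⟨𝟙 _, act_id _⟩
  comp f g := ⟨f.1 ≫ g.1, by rw [act_comp, g.2, f.2]⟩

variable (M) in
/-- The projection from the category of elements. -/
noncomputable def Elt.proj : Elt M ⥤ D where
  obj := Elt.obj
  map f := f.1

variable (κ i) in
/-- The condition that `D` has `κ`-small colimits, which `i : D ⥤ A` preserves. -/
def HasSmallColimits : Prop := ∀ (K : Type w) [SmallCategory K] (_ : HasCardinalLT (Arrow K) κ)
  (G : K ⥤ D), ∃ c : Cocone G, Nonempty (IsColimit (i.mapCocone c))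

/-- A `κ`-small diagram of elements is a compatible family over its projection to `D`; an element
over the colimit there is a cocone on it. -/
lemma Elt.isCardinalFiltered (H : HasSmallColimits κ i) : IsCardinalFiltered (Elt M) κ where
  nonempty_cocone {K _} F hK := by
    obtain ⟨c, ⟨hc⟩⟩ := H K hK (F ⋙ Elt.proj M)
    obtain ⟨n, hn⟩ := exists_act_eq (M := M) hK hc (fun k => (F.obj k).elt)
      fun f => (F.map f).2
    exact ⟨{
      pt := ⟨c.pt, n⟩
      ι :=
        { app k := ⟨c.ι.app k, hn k⟩
          naturality k k' f := Subtype.ext (c.ι.naturality f) } }⟩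

section

variable [HasColimitsOfSize.{w, w} A]

variable (M) in
/-- The comparison from a model to the morphisms to its realization. -/
noncomputable def toRealization (d : D) (x : M.obj.carrier d) :
    i.obj d ⟶ colimit (Elt.proj M ⋙ i) :=
  colimit.ι (Elt.proj M ⋙ i) ⟨d, x⟩

lemma toRealization_act {d d' : D} (u : d' ⟶ d) (x : M.obj.carrier d) :
    toRealization M d' (act M u x) = i.map u ≫ toRealization M d x :=
  (colimit.w (Elt.proj M ⋙ i)
    (show (⟨d', act M u x⟩ : Elt M) ⟶ ⟨d, x⟩ from ⟨u, rfl⟩)).symm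

variable [i.Full] [i.Faithful] [∀ d, IsCardinalPresentable (i.obj d) κ]

/-- The realization is a `κ`-filtered colimit, so a morphism from the presentable `i.obj d` factors
through a stage `i.obj j.obj`. Fullness turns the factor into a morphism of `D`, which acts on
`j.elt`; faithfulness gives injectivity. -/
lemma bijective_toRealization (H : HasSmallColimits κ i) (d : D) :
    Function.Bijective (toRealization M d) := by
  have := Elt.isCardinalFiltered (M := M) H
  constructor
  · intro x y h
    obtain ⟨k, f, g, e⟩ := IsCardinalPresentable.exists_eq_of_isColimit κ
      (colimit.isColimit (Elt.proj M ⋙ i)) (X := i.obj d) (i₁ := ⟨d, x⟩) (i₂ := ⟨d, y⟩)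
      (𝟙 _) (𝟙 _) (((Category.id_comp _).trans h).trans (Category.id_comp _).symm)
    have e' : f.1 = g.1 := i.map_injective
      (((Category.id_comp _).symm.trans e).trans (Category.id_comp _))
    exact f.2.symm.trans ((congrArg (fun u => act M u k.elt) e').trans g.2)
  · intro g
    obtain ⟨j, g', rfl⟩ := IsCardinalPresentable.exists_hom_of_isColimit κ
      (colimit.isColimit (Elt.proj M ⋙ i)) g
    obtain ⟨u, rfl⟩ := i.map_surjective g'
    exact ⟨act M u j.elt, toRealization_act u j.elt⟩

variable (M) in
/-- The homomorphism from a model to the nerve of its realization. -/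
noncomputable def toNerve : M ⟶ (nerve κ i).obj (colimit (Elt.proj M ⋙ i)) :=
  ObjectProperty.homMk
    { toFun := toRealization M
      map_func g x v hv := by
        obtain ⟨n, hn, rfl⟩ := exists_of_mem_func hv
        exact mem_nerveStr_func.2 ⟨toRealization M _ n,
          fun k => (toRealization_act _ _).symm.trans (congrArg (toRealization M _) (hn k)),
          (toRealization_act _ _).symm⟩
      map_rel R := R.elim }

lemma isIso_toNerve (H : HasSmallColimits κ i) : IsIso (toNerve M) := by
  have inj {d} := (bijective_toRealization (M := M) H d).injective
  refine isIso_of_bijective _ (bijective_toRealization H) (fun g m v hv => ?_) fun R => R.elim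
  obtain ⟨h, hm, hv'⟩ := mem_nerveStr_func.1 hv
  obtain ⟨n, rfl⟩ := (bijective_toRealization H _).surjective h
  obtain rfl : (fun k => act M (ConeOp.leg g k) n) = m :=
    funext fun k => inj ((toRealization_act _ _).trans (hm k))
  obtain rfl : act M (ConeOp.out g) n = v := inj ((toRealization_act _ _).trans hv')
  exact act_out_mem g n

end

/-! ### Density and full faithfulness of the nerve -/

omit [Fact κ.IsRegular] in
lemma denseAt_ι_app_comp [i.IsDense] {X Y : A} (p : CostructuredArrow i X) (f : X ⟶ Y) :
    ((Functor.LeftExtension.mk _ i.rightUnitor.inv).coconeAt X).ι.app p ≫ f =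
      (show i.obj p.left ⟶ X from p.hom) ≫ f :=
  congrArg (· ≫ f) (Category.id_comp (show i.obj p.left ⟶ X from p.hom))

instance [i.IsDense] : (nerve κ i).Faithful where
  map_injective {X Y f g} h := (i.denseAt X).hom_ext fun p => by
    rw [denseAt_ι_app_comp, denseAt_ι_app_comp]
    exact congrArg (fun a => appl a p.left (show i.obj p.left ⟶ X from p.hom)) h

instance [i.IsDense] : (nerve κ i).Full where
  map_surjective {X Y} a := by
    -- A homomorphism of nerves commutes with the action of `D`, hence gives a cocone on the
    -- canonical diagram of `X`, whose colimit is `X` by density.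
    let c : Cocone (CostructuredArrow.proj i X ⋙ i) :=
      { pt := Y
        ι :=
          { app p := appl a p.left p.hom
            naturality p q f := by
              have h := act_hom a f.left q.hom
              exact (act_nerve (X := Y) _ _).symm.trans (h.symm.trans ((congrArg (appl a p.left)
                ((act_nerve (X := X) _ _).trans (CostructuredArrow.w f))).trans
                  (Category.comp_id _).symm)) } }
    refine ⟨(i.denseAt X).desc c, hom_ext' fun d x => ?_⟩
    exact (denseAt_ι_app_comp (.mk x) _).symm.trans ((i.denseAt X).fac c (.mk x))

lemma isEquivalence_nerve [HasColimitsOfSize.{w, w} A] [i.Full] [i.Faithful] [i.IsDense]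
    [∀ d, IsCardinalPresentable (i.obj d) κ] (H : HasSmallColimits κ i) :
    (nerve κ i).IsEquivalence where
  essSurj := ⟨fun M => by
    have := isIso_toNerve (M := M) H
    exact ⟨_, ⟨(asIso (toNerve M)).symm⟩⟩⟩

end Nerve

/-! ### Application to the presentable objects -/

/-- A locally `κ`-presentable category is the category of models of a partial Horn theory. -/
lemma exists_equivalence_PMod (κ : Cardinal.{w}) [Fact κ.IsRegular] (A : Type u) [Category.{v} A]
    [IsCardinalLocallyPresentable A κ] :
    ∃ (S : Type w) (Sg : Signature κ S) (T : Theory Sg), Nonempty (A ≌ PMod T) := by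
  -- The carriers of the nerve are hom-sets, so they must first be brought into universe `w`.
  obtain ⟨B, _, ⟨e⟩⟩ := HasCardinalFilteredGenerator.exists_equivalence A κ
  have : IsCardinalLocallyPresentable B κ := e.isCardinalLocallyPresentable κ
  let P := isCardinalPresentable B κ
  let ε := equivSmallModel.{w} P.FullSubcategory
  let i : SmallModel.{w} P.FullSubcategory ⥤ B := ε.inverse ⋙ P.ι
  have hi : ∀ d, IsCardinalPresentable (i.obj d) κ := fun d => (ε.inverse.obj d).property
  have H : HasSmallColimits κ i := fun K _ hK G => by
    -- A `κ`-small colimit of `κ`-presentable objects is `κ`-presentable, so it can be formed in the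
    -- subcategory and is preserved by the inclusion.
    have : P.IsClosedUnderColimitsOfShape K :=
      isClosedUnderColimitsOfShape_isCardinalPresentable B hK
    have : HasColimitsOfShape K (SmallModel.{w} P.FullSubcategory) :=
      Adjunction.hasColimitsOfShape_of_equivalence ε.inverse
    exact ⟨colimit.cocone G, ⟨isColimitOfPreserves i (colimit.isColimit G)⟩⟩
  have := isEquivalence_nerve (κ := κ) H
  exact ⟨_, _, nerveTheory κ i, ⟨e.trans (nerve κ i).asEquivalence⟩⟩

end PartialHorn

theorem mainTheorem8 (κ : Cardinal.{w}) [Fact κ.IsRegular]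
    (A : Type u) [Category.{v} A] :
    IsCardinalLocallyPresentable A κ ↔
      ∃ (S : Type w) (Sg : PartialHorn.Signature κ S) (T : PartialHorn.Theory Sg),
        Nonempty (A ≌ PartialHorn.PMod T) :=
  ⟨fun _ => PartialHorn.exists_equivalence_PMod κ A,
    fun ⟨_, _, _, ⟨e⟩⟩ => e.symm.isCardinalLocallyPresentable κ⟩
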